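/- Consider a cell that is a disc of radius $R>0$ with a base station (BS) at its centre, serving $U_c\ge 1$ cellular users with $T_c$ antennas, total transmit power $P_c>0$ and precoding matrix $\mathbf V\in\mathbb C^{T_c\times U_c}$. A typical device-to-device (D2D) receiver is placed at the origin. Its own transmitter (index $0$) is at fixed distance $R_{0,0}>0$; the other D2D transmitters (indices $j\ne 0$) form a homogeneous Poisson point process in $\mathbb R^2$ of density $\lambda_d>0$, and $R_{0,j}$ is the distance of the $j$-th one from the origin. Every D2D transmitter uses power $P_d>0$. The pathloss at distance $d$ is $A_{0,c}d^{-\alpha_c}$ between a user and the BS and $A_{0,d}d^{-\alpha_d}$ between two users, where $A_{0,c},A_{0,d}>0$, $\alpha_c>0$, $\alpha_d>2$. The D2D fading coefficients $g_{0,j}$ are independent with law $\mathcal{CN}(0,1)$, the noise power is $N_0\ge 0$, and $\mathbf f_{0,\mathrm{BS}}\in\mathbb C^{T_c}$ is the channel from the BS to the typical receiver. The SINR of the typical receiver is $$\mathrm{SINR}_{d,0}=\frac{P_dR_{0,0}^{-\alpha_d}|g_{0,0}|^2}{I_{\mathrm{BS},0}+I_{d,0}+N_0/A_{0,d}},\qquad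 I_{\mathrm{BS},0}=\frac{A_{0,c}}{A_{0,d}}\frac{P_c}{U_c}R_{0,\mathrm{BS}}^{-\alpha_c}\|\mathbf f_{0,\mathrm{BS}}^H\mathbf V\|^2,\qquad I_{d,0}=\sum_{j\ne 0}P_dR_{0,j}^{-\alpha_d}|g_{0,j}|^2 .$$ Suppose that the typical receiver is uniformly distributed over the cell relative to the BS, $R_{0,\mathrm{BS}}$ being its distance to the BS; that $2\|\mathbf f_{0,\mathrm{BS}}^H\mathbf V\|^2\sim\chi^2_{2U_c}$ (the chi-squared approximation is taken as the model of this norm); and that the family of the $g_{0,j}$, the process of the interfering transmitters, the relative position of the receiver and the BS, and $\|\mathbf f_{0,\mathrm{BS}}^H\mathbf V\|^2$ are mutually independent. Then for every threshold $\beta_d>0$ the coverage probability is $$\Pr\{\mathrm{SINR}_{d,0}\ge\beta_d\}=\frac{\kappa^{2/\alpha_c}}{R^2}\Big[y^{U_c+\frac2{\alpha_c}-1}(1-y)^{-\frac2{\alpha_c}}-\Big(U_c+\frac2{\alpha_c}-1\Big)\mathcal B\Big(y;U_c+\frac2{\alpha_c}-1,1-\frac2{\alpha_c}\Big)\Big]\exp\Big(-\frac{\pi\lambda_dR_{0,0}^2}{\mathrm{sinc}(2/\alpha_d)}\beta_d^{2/\alpha_d}\Big)\exp\Big(-\beta_dx\frac{N_0}{A_{0,d}}\Big),$$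 where $x=R_{0,0}^{\alpha_d}/P_d$, $\kappa=\beta_dx\frac{A_{0,c}}{A_{0,d}}\frac{P_c}{U_c}$, $y=\frac1{\kappa R^{-\alpha_c}+1}$, $\mathrm{sinc}(z)=\frac{\sin(\pi z)}{\pi z}$, and $\mathcal B(y;a,b)=\int_0^yt^{a-1}(1-t)^{b-1}\,dt$ is the incomplete Beta function. -/

import Mathlib

open MeasureTheory ProbabilityTheory
open scoped ENNReal

/-- The Euclidean plane. -/
abbrev Plane : Type := EuclideanSpace ℝ (Fin 2)

/-- The standard circularly symmetric complex Gaussian law `CN(0,1)`: independent real and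
imaginary parts, each of law `N(0, 1/2)`. -/
noncomputable def stdComplexGaussian : Measure ℂ :=
  ((gaussianReal 0 (1 / 2)).prod (gaussianReal 0 (1 / 2))).map (fun z : ℝ × ℝ => (⟨z.1, z.2⟩ : ℂ))

/-- The chi-squared law with `k` degrees of freedom: the law of the sum of the squares of `k`
independent standard normal variables. -/
noncomputable def chiSquared (k : ℕ) : Measure ℝ :=
  (Measure.pi (fun _ : Fin k => gaussianReal 0 1)).map (fun z => ∑ i, z i ^ 2)

/-- The normalized cardinal sine `sin (π z) / (π z)` (with value `1` at `z = 0`). -/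
noncomputable def normalizedSinc (z : ℝ) : ℝ := Real.sinc (Real.pi * z)

/-- The incomplete Beta function `B(y; a, b) = ∫₀^y t^(a-1) (1-t)^(b-1) dt`. -/
noncomputable def incompleteBeta (y a b : ℝ) : ℝ :=
  ∫ t in (0 : ℝ)..y, t ^ (a - 1) * (1 - t) ^ (b - 1)

section PoissonProcess

variable {Ω E : Type*} [MeasurableSpace Ω] [MeasurableSpace E]

/-- The number of indices `j` for which the random point `X j` lies in `B`. -/
noncomputable def pointCount (X : ℕ → Ω → E) (B : Set E) (ω : Ω) : ℕ∞ :=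
  {j : ℕ | X j ω ∈ B}.encard

/-- The random points `X 0, X 1, …` enumerate a Poisson point process with intensity measure `ν`:
the number of points in a measurable set `B` with `ν B < ∞` is Poisson distributed with mean
`ν B`, and the numbers of points in pairwise disjoint sets are independent. -/
structure IsPoissonPointProcess (X : ℕ → Ω → E) (ν : Measure E) (μ : Measure Ω) : Prop where
  measurable_point : ∀ j, Measurable (X j)
  count_law : ∀ B : Set E, MeasurableSet B → ν B < ∞ →
    HasLaw (pointCount X B) ((poissonMeasure (ν B).toNNReal).map (Nat.cast : ℕ → ℕ∞)) μ
  count_indep : ∀ (n : ℕ) (B : Fin n → Set E), (∀ i, MeasurableSet (B i)) → (∀ i, ν (B i) < ∞) →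
    Pairwise (fun i k => Disjoint (B i) (B k)) → iIndepFun (fun i => pointCount X (B i)) μ

end PoissonProcess

/-- The numerical parameters of the network. -/
structure NetworkParams where
  /-- radius of the cell -/
  R : ℝ
  /-- number of antennas of the base station -/
  Tc : ℕ
  /-- number of cellular users -/
  Uc : ℕ
  /-- total transmit power of the base station -/
  Pc : ℝ
  /-- transmit power of a D2D transmitter -/
  Pd : ℝ
  /-- pathloss coefficient between a user and the base station -/
  Ac : ℝ
  /-- pathloss coefficient between two users -/
  Ad : ℝ
  /-- pathloss exponent between a user and the base station -/
  αc : ℝ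
  /-- pathloss exponent between two users -/
  αd : ℝ
  /-- density of the D2D transmitters -/
  lamd : ℝ
  /-- distance between a D2D transmitter and its own receiver -/
  R00 : ℝ
  /-- noise power -/
  N0 : ℝ

/-- The random quantities seen by the typical D2D receiver, which sits at the origin. -/
structure TypicalReceiver (p : NetworkParams) (Ω : Type*) where
  /-- position of the `j`-th D2D transmitter; number `0` is the transmitter of the typical pair -/
  tx : ℕ → Ω → Plane
  /-- fading coefficient from the `j`-th D2D transmitter to the typical receiver -/
  g : ℕ → Ω → ℂ
  /-- position of the base station relative to the typical receiver -/
  bs : Ω → Plane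
  /-- channel response from the base station to the typical receiver -/
  f : Ω → Fin p.Tc → ℂ
  /-- precoding matrix of the base station -/
  V : Ω → Fin p.Tc → Fin p.Uc → ℂ

namespace TypicalReceiver

variable {p : NetworkParams} {Ω : Type*}

/-- `‖fᴴ V‖²`. -/
noncomputable def bsGain (m : TypicalReceiver p Ω) (ω : Ω) : ℝ :=
  ∑ u, ‖∑ t, (starRingEnd ℂ) (m.f ω t) * m.V ω t u‖ ^ 2

/-- The (normalized) interference power received from the base station. -/
noncomputable def bsInterference (m : TypicalReceiver p Ω) (ω : Ω) : ℝ :=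
  p.Ac / p.Ad * (p.Pc / p.Uc) * ‖m.bs ω‖ ^ (-p.αc) * m.bsGain ω

/-- The (normalized) interference power received from the other D2D transmitters, as an infinite
series of nonnegative terms with values in `[0, ∞]`. -/
noncomputable def d2dInterference (m : TypicalReceiver p Ω) (ω : Ω) : ℝ≥0∞ :=
  ∑' j : ℕ, ENNReal.ofReal (p.Pd * ‖m.tx (j + 1) ω‖ ^ (-p.αd) * ‖m.g (j + 1) ω‖ ^ 2)

/-- The signal-to-interference-plus-noise ratio at the typical D2D receiver. -/
noncomputable def sinr (m : TypicalReceiver p Ω) (ω : Ω) : ℝ≥0∞ :=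
  ENNReal.ofReal (p.Pd * ‖m.tx 0 ω‖ ^ (-p.αd) * ‖m.g 0 ω‖ ^ 2) /
    (ENNReal.ofReal (m.bsInterference ω) + m.d2dInterference ω + ENNReal.ofReal (p.N0 / p.Ad))

/-- The probability that the SINR is at least the threshold `β`. -/
noncomputable def coverageProbability [MeasurableSpace Ω] (m : TypicalReceiver p Ω)
    (μ : Measure Ω) (β : ℝ) : ℝ :=
  μ.real {ω | ENNReal.ofReal β ≤ m.sinr ω}

/-- The probabilistic model of the network. -/
structure IsModel [MeasurableSpace Ω] (m : TypicalReceiver p Ω) (μ : Measure Ω) : Prop where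
  measurable_g : ∀ j, Measurable (m.g j)
  measurable_bs : Measurable m.bs
  measurable_f : Measurable m.f
  measurable_V : Measurable m.V
  /-- The transmitter of the typical pair is at distance `R00` from its receiver. -/
  norm_tx_zero : ∀ ω, ‖m.tx 0 ω‖ = p.R00
  /-- The other D2D transmitters form a homogeneous Poisson process of density `λ_d`. -/
  tx_poisson : IsPoissonPointProcess (fun j => m.tx (j + 1)) (ENNReal.ofReal p.lamd • volume) μ
  /-- Rayleigh fading: the coefficients `g j` are independent with law `CN(0,1)`. -/
  g_law : ∀ j, HasLaw (m.g j) stdComplexGaussian μ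
  g_indep : iIndepFun m.g μ
  /-- The typical receiver is uniformly distributed over the cell around the base station. -/
  bs_uniform : pdf.IsUniform m.bs (Metric.closedBall 0 p.R) μ
  /-- The chi-squared model `2 ‖fᴴ V‖² ∼ χ²_{2 U_c}`. -/
  gain_law : HasLaw (fun ω => 2 * m.bsGain ω) (chiSquared (2 * p.Uc)) μ
  /-- The D2D fading, the positions of the interferers, the position of the base station and the
  gain `‖fᴴ V‖²` are mutually independent (this field and the next two). -/
  indep_fading : IndepFun (fun ω j => m.g j ω)
    (fun ω => ((fun j => m.tx (j + 1) ω : ℕ → Plane), m.bs ω, m.bsGain ω)) μ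
  indep_tx : IndepFun (fun ω j => m.tx (j + 1) ω) (fun ω => (m.bs ω, m.bsGain ω)) μ
  indep_bs : IndepFun m.bs m.bsGain μ

end TypicalReceiver

/-! Since `|g₀|²` is exponential with mean 1, conditioning on everything else turns the coverage
probability into `E exp(-β x (I_BS + I_d + N₀/A_d))`. By independence this is a product of two
Laplace transforms and the noise factor.

D2D factor: integrating out each fading coefficient gives `1/(1 + s‖X_j‖^(-α))` with `s = β R₀₀^α`,
which is `exp(-φ(X_j))` for `φ = log(1 + s‖·‖^(-α))`. The Laplace functional of the Poisson process
(`lintegral_negExp_tsum`) yields `exp(-λ ∫ (1 - e^(-φ)))`, and polar coordinates with Euler's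
reflection formula evaluate the integral (`lintegral_one_sub_negExp_log_pathloss`).

Base-station factor: the chi-squared transform gives `(1 + κ r^(-α))^(-U)` at distance `r`. The
average over the disc is computed with the variable `y = 1/(κ r^(-α) + 1)` and an explicit
antiderivative (`integral_mul_inv_one_add_rpow_pow`).

Interference takes values in `[0, ∞]` and `exp(-∞) = 0`, so almost sure convergence of the
interference series is never needed. -/

/-! ### The exponential on `[0, ∞]`. -/

/-- The function `a ↦ exp (-a)` on `[0, ∞]`, with `exp (-∞) = 0`. -/
noncomputable def negExp (a : ℝ≥0∞) : ℝ≥0∞ := EReal.exp (-(a : EReal))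

theorem negExp_zero : negExp 0 = 1 := by simp [negExp]

theorem negExp_top : negExp ∞ = 0 := by simp [negExp]

theorem negExp_ofReal {r : ℝ} (hr : 0 ≤ r) :
    negExp (ENNReal.ofReal r) = ENNReal.ofReal (Real.exp (-r)) := by
  rw [negExp, EReal.coe_ennreal_ofReal, max_eq_left hr, ← EReal.coe_neg, EReal.exp_coe]

theorem negExp_add (a b : ℝ≥0∞) : negExp (a + b) = negExp a * negExp b := by
  rw [negExp, negExp, negExp, ← EReal.exp_add, EReal.coe_ennreal_add, EReal.neg_add, sub_eq_add_neg]
  · left; simp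
  · right; simp

theorem negExp_antitone : Antitone negExp := fun _ _ h =>
  EReal.exp_monotone (EReal.neg_le_neg_iff.2 (EReal.coe_ennreal_le_coe_ennreal_iff.2 h))

theorem negExp_le_one (a : ℝ≥0∞) : negExp a ≤ 1 := negExp_zero ▸ negExp_antitone zero_le

theorem continuous_negExp : Continuous negExp :=
  EReal.expHomeomorph.continuous.comp (continuous_neg.comp continuous_coe_ennreal_ereal)

theorem measurable_negExp : Measurable negExp := continuous_negExp.measurable

theorem negExp_sum {ι : Type*} (s : Finset ι) (a : ι → ℝ≥0∞) :
    negExp (∑ i ∈ s, a i) = ∏ i ∈ s, negExp (a i) := by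
  classical
  induction s using Finset.induction_on with
  | empty => simp [negExp_zero]
  | insert i s hi ih => rw [Finset.sum_insert hi, Finset.prod_insert hi, negExp_add, ih]

theorem negExp_natCast_mul (n : ℕ) (a : ℝ≥0∞) : negExp (n * a) = negExp a ^ n := by
  have := negExp_sum (Finset.range n) (fun _ => a)
  simpa using this

theorem tendsto_negExp_sum_range (a : ℕ → ℝ≥0∞) :
    Filter.Tendsto (fun n => negExp (∑ i ∈ Finset.range n, a i)) Filter.atTop
      (nhds (negExp (∑' i, a i))) :=
  (continuous_negExp.tendsto _).comp (ENNReal.tendsto_nat_tsum a)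

/-! ### Laplace functional of a Poisson process. -/

/-- This is the Poisson generating function at `q = exp(-c)`; `c = ∞` is included, with `q = 0`. -/
theorem lintegral_negExp_poissonMeasure (r : NNReal) (c : ℝ≥0∞) :
    ∫⁻ k, negExp (c * k) ∂(poissonMeasure r) = negExp (r * (1 - negExp c)) := by
  obtain ⟨q, hq⟩ : ∃ q : NNReal, negExp c = q :=
    ⟨_, (ENNReal.coe_toNNReal ((negExp_le_one c).trans_lt ENNReal.one_lt_top).ne).symm⟩
  have hq1 : q ≤ 1 := by exact_mod_cast hq ▸ negExp_le_one c
  have hr : (r : ℝ≥0∞) * (1 - q) = ENNReal.ofReal (r * (1 - q)) := by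
    rw [ENNReal.ofReal_mul (by positivity), ENNReal.ofReal_sub _ (by positivity)]
    simp
  rw [hq, hr, negExp_ofReal (mul_nonneg r.coe_nonneg (sub_nonneg.2 (by exact_mod_cast hq1))),
    poissonMeasure, lintegral_sum_measure]
  simp_rw [lintegral_smul_measure, lintegral_dirac, mul_comm c, negExp_natCast_mul, hq]
  have h : HasSum (fun n : ℕ => Real.exp (-r) * ((r * q) ^ n / n.factorial))
      (Real.exp (-r) * Real.exp (r * q)) := by
    rw [Real.exp_eq_exp_ℝ]
    exact (NormedSpace.expSeries_div_hasSum_exp (r * q : ℝ)).mul_left _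
  have e : Real.exp (-(r * (1 - q))) = Real.exp (-r) * Real.exp (r * q) := by
    rw [← Real.exp_add]; congr 1; ring
  rw [e, ← h.tsum_eq, ENNReal.ofReal_tsum_of_nonneg (fun n => by positivity) h.summable]
  refine tsum_congr fun n => ?_
  rw [smul_eq_mul, ← ENNReal.coe_pow, ← ENNReal.ofReal_coe_nnreal, ← ENNReal.ofReal_mul (by positivity)]
  congr 1
  push_cast
  ring

theorem tsum_indicator_eq_mul_pointCount {Ω E : Type*} (X : ℕ → Ω → E) (B : Set E) (c : ℝ≥0∞) (ω : Ω) :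
    ∑' j, B.indicator (fun _ => c) (X j ω) = c * (pointCount X B ω : ℝ≥0∞) := by
  rw [pointCount, mul_comm, ← ENNReal.tsum_set_const, tsum_subtype {j | X j ω ∈ B} (fun _ => c)]
  rfl

section

variable {Ω E : Type*} [MeasurableSpace Ω] [MeasurableSpace E] {X : ℕ → Ω → E} {ν : Measure E}
  {μ : Measure Ω}

namespace IsPoissonPointProcess

theorem lintegral_negExp_mul_pointCount (h : IsPoissonPointProcess X ν μ) {B : Set E}
    (hB : MeasurableSet B) (hν : ν B ≠ ∞) (c : ℝ≥0∞) :
    ∫⁻ ω, negExp (c * (pointCount X B ω : ℝ≥0∞)) ∂μ = negExp (ν B * (1 - negExp c)) := by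
  have hl := h.count_law B hB hν.lt_top
  have hm : Measurable fun k : ℕ∞ => negExp (c * (k : ℝ≥0∞)) := .of_discrete
  rw [← lintegral_map' (f := fun k : ℕ∞ => negExp (c * (k : ℝ≥0∞))) hm.aemeasurable hl.aemeasurable,
    hl.map_eq, lintegral_map hm .of_discrete]
  simpa [ENNReal.coe_toNNReal hν] using lintegral_negExp_poissonMeasure (ν B).toNNReal c

/-- `HasLaw` makes the count only almost everywhere measurable; writing it as a series of indicators
of measurable points gives true measurability. -/
theorem measurable_mul_pointCount (h : IsPoissonPointProcess X ν μ) {B : Set E}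
    (hB : MeasurableSet B) (c : ℝ≥0∞) :
    Measurable fun ω => c * (pointCount X B ω : ℝ≥0∞) := by
  simp_rw [← tsum_indicator_eq_mul_pointCount]
  exact Measurable.tsum fun j =>
    (measurable_const.indicator hB).comp (h.measurable_point j)

/-- The Laplace functional of a Poisson point process, for simple functions. -/
theorem lintegral_negExp_tsum_simpleFunc (h : IsPoissonPointProcess X ν μ) (φ : SimpleFunc E ℝ≥0∞)
    (hφ : ν (Function.support φ) ≠ ∞) :
    ∫⁻ ω, negExp (∑' j, φ (X j ω)) ∂μ = negExp (∫⁻ x, (1 - negExp (φ x)) ∂ν) := by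
  classical
  -- The value 0 is dropped because its fibre may have infinite measure; it contributes nothing to
  -- either side.
  set s := φ.range.filter (· ≠ 0) with hs
  have hν : ∀ c ∈ s, ν (φ ⁻¹' {c}) ≠ ∞ := fun c hc => by
    refine ne_top_of_le_ne_top hφ (measure_mono fun x hx => ?_)
    have hx : φ x = c := hx
    rw [Function.mem_support, hx]
    exact (Finset.mem_filter.1 hc).2
  have hsum : ∀ ω, ∑' j, φ (X j ω) = ∑ c ∈ s, c * (pointCount X (φ ⁻¹' {c}) ω : ℝ≥0∞) := fun ω => by
    simp_rw [← tsum_indicator_eq_mul_pointCount]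
    rw [← Summable.tsum_finsetSum fun _ _ => ENNReal.summable]
    refine tsum_congr fun j => ?_
    have hi : ∀ c, (φ ⁻¹' {c}).indicator (fun _ => c) (X j ω) = if φ (X j ω) = c then c else 0 :=
      fun c => by simp [Set.indicator_apply]
    simp_rw [hi]
    rw [Finset.sum_ite_eq]
    split_ifs with hc
    · rfl
    · by_contra h0
      exact hc (Finset.mem_filter.2 ⟨φ.mem_range_self _, h0⟩)
  -- Fibres over distinct values are disjoint, so their counts are independent and the expectation
  -- of the product factors.
  have hind : iIndepFun (fun (c : s) ω => negExp (c * (pointCount X (φ ⁻¹' {c.1}) ω : ℝ≥0∞))) μ := by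
    have e := s.equivFin
    have := h.count_indep s.card (fun i => φ ⁻¹' {(e.symm i).1}) (fun i => φ.measurableSet_fiber _)
      (fun i => (hν _ (e.symm i).2).lt_top) (fun i k hik => by
        refine Disjoint.preimage _ (Set.disjoint_singleton.2 fun hc => hik ?_)
        exact e.symm.injective (Subtype.ext hc))
    have h2 := (this.precomp e.injective).comp (fun c k => negExp (c * (k : ℝ≥0∞)))
      (fun c => .of_discrete)
    simpa [Function.comp_def] using h2
  simp_rw [hsum, negExp_sum, ← Finset.prod_coe_sort s]
  rw [lintegral_prod_eq_prod_lintegral_of_indepFun _ _ hind fun c =>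
    measurable_negExp.comp (h.measurable_mul_pointCount (φ.measurableSet_fiber _) _)]
  simp_rw [fun c : s => h.lintegral_negExp_mul_pointCount (φ.measurableSet_fiber c.1) (hν _ c.2) c.1]
  rw [← negExp_sum, Finset.sum_coe_sort s (fun c => ν (φ ⁻¹' {c}) * (1 - negExp c))]
  congr 1
  have := (φ.map fun c => 1 - negExp c).lintegral_eq_lintegral ν
  simp only [SimpleFunc.map_apply] at this
  rw [this, SimpleFunc.map_lintegral, hs, Finset.sum_filter]
  refine Finset.sum_congr rfl fun c _ => ?_
  split_ifs with hc
  · rw [mul_comm]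
  · simp [not_not.1 hc, negExp_zero]

/-- The Laplace functional of a Poisson point process. -/
theorem lintegral_negExp_tsum [IsProbabilityMeasure μ] [SigmaFinite ν]
    (h : IsPoissonPointProcess X ν μ) {φ : E → ℝ≥0∞} (hφ : Measurable φ) :
    ∫⁻ ω, negExp (∑' j, φ (X j ω)) ∂μ = negExp (∫⁻ x, (1 - negExp (φ x)) ∂ν) := by
  -- Cutting off along the spanning sets gives supports of finite measure and keeps the
  -- approximation monotone.
  let ψ : ℕ → SimpleFunc E ℝ≥0∞ := fun n => (SimpleFunc.eapprox φ n).restrict (spanningSets ν n)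
  have hψ : ∀ n x, ψ n x = (spanningSets ν n).indicator (SimpleFunc.eapprox φ n) x := fun n x =>
    SimpleFunc.restrict_apply _ (measurableSet_spanningSets ν n) x
  have hmono : ∀ x, Monotone fun n => ψ n x := fun x m n hmn => by
    simp only [hψ]
    exact (Set.indicator_le_indicator_of_subset (monotone_spanningSets ν hmn) (fun _ => zero_le) x).trans
      (Set.indicator_le_indicator (SimpleFunc.monotone_eapprox φ hmn x))
  have hlim : ∀ x, Filter.Tendsto (fun n => ψ n x) Filter.atTop (nhds (φ x)) := fun x => by
    refine (SimpleFunc.tendsto_eapprox hφ x).congr' ?_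
    filter_upwards [Filter.eventually_ge_atTop (spanningSetsIndex ν x)] with n hn
    rw [hψ, Set.indicator_of_mem (mem_spanningSets_of_index_le ν x hn)]
  have hfin : ∀ n, ν (Function.support (ψ n)) ≠ ∞ := fun n => by
    refine ne_top_of_le_ne_top (measure_spanningSets_lt_top ν n).ne (measure_mono fun x hx => ?_)
    rw [Function.mem_support, hψ] at hx
    exact Set.mem_of_indicator_ne_zero hx
  have hL : Filter.Tendsto (fun n => ∫⁻ ω, negExp (∑' j, ψ n (X j ω)) ∂μ) Filter.atTop
      (nhds (∫⁻ ω, negExp (∑' j, φ (X j ω)) ∂μ)) := by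
    refine tendsto_lintegral_of_dominated_convergence (fun _ => 1) (fun n => ?_)
      (fun n => Filter.Eventually.of_forall fun ω => negExp_le_one _) (by simp)
      (Filter.Eventually.of_forall fun ω => ?_)
    · exact measurable_negExp.comp (Measurable.tsum fun j =>
        (ψ n).measurable.comp (h.measurable_point j))
    · refine (continuous_negExp.tendsto _).comp ?_
      -- As an integral against counting measure, the series passes to the limit by monotone
      -- convergence.
      simp_rw [← lintegral_count]
      exact lintegral_tendsto_of_tendsto_of_monotone (fun n => measurable_from_nat.aemeasurable)
        (Filter.Eventually.of_forall fun j => hmono _) (Filter.Eventually.of_forall fun j => hlim _)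
  have hR : Filter.Tendsto (fun n => negExp (∫⁻ x, (1 - negExp (ψ n x)) ∂ν)) Filter.atTop
      (nhds (negExp (∫⁻ x, (1 - negExp (φ x)) ∂ν))) := by
    refine (continuous_negExp.tendsto _).comp ?_
    refine lintegral_tendsto_of_tendsto_of_monotone
      (fun n => (measurable_const.sub (measurable_negExp.comp (ψ n).measurable)).aemeasurable)
      (Filter.Eventually.of_forall fun x m n hmn =>
        tsub_le_tsub_left (negExp_antitone (hmono x hmn)) _) (Filter.Eventually.of_forall fun x => ?_)
    exact ENNReal.Tendsto.sub tendsto_const_nhds ((continuous_negExp.tendsto _).comp (hlim x))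
      (Or.inl ENNReal.one_ne_top)
  refine tendsto_nhds_unique hL (hR.congr fun n => ?_)
  rw [h.lintegral_negExp_tsum_simpleFunc (ψ n) (hfin n)]

end IsPoissonPointProcess

end

/-! ### Transforms of the Gaussian and chi-squared laws. -/

theorem stdComplexGaussian_eq_withDensity :
    stdComplexGaussian =
      volume.withDensity fun z : ℂ => ENNReal.ofReal (Real.pi⁻¹ * Real.exp (-‖z‖ ^ 2)) := by
  refine Measure.ext_of_lintegral _ fun f hf => ?_
  have hm : Measurable (fun z : ℝ × ℝ => (⟨z.1, z.2⟩ : ℂ)) :=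
    Complex.measurableEquivRealProd.symm.measurable
  rw [stdComplexGaussian, lintegral_map hf hm, gaussianReal_of_var_ne_zero _ (by simp),
    prod_withDensity (measurable_gaussianPDF _ _) (measurable_gaussianPDF _ _),
    lintegral_withDensity_eq_lintegral_mul (g := fun z : ℝ × ℝ => f ⟨z.1, z.2⟩) _ (by fun_prop)
      (hf.comp hm),
    lintegral_withDensity_eq_lintegral_mul _ (by fun_prop) hf,
    ← Complex.volume_preserving_equiv_real_prod.symm.lintegral_comp_emb
      Complex.measurableEquivRealProd.symm.measurableEmbedding]
  refine lintegral_congr fun z => ?_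
  simp only [Pi.mul_apply, Complex.measurableEquivRealProd_symm_apply]
  congr 1
  rw [gaussianPDF, gaussianPDF, ← ENNReal.ofReal_mul (gaussianPDFReal_nonneg _ _ _), gaussianPDFReal,
    gaussianPDFReal, ← Complex.normSq_eq_norm_sq, Complex.normSq_mk]
  congr 1
  have h : (√(2 * Real.pi * ((1 / 2 : NNReal) : ℝ)))⁻¹ * (√(2 * Real.pi * ((1 / 2 : NNReal) : ℝ)))⁻¹
      = Real.pi⁻¹ := by
    rw [← mul_inv, Real.mul_self_sqrt (by positivity)]
    congr 1
    push_cast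
    ring
  rw [mul_mul_mul_comm, h, ← Real.exp_add]
  congr 2
  push_cast
  ring

/-- Polar coordinates, stated for any two-dimensional space so as to serve both `ℂ` (fading) and
`Plane` (positions). -/
theorem integral_fun_norm_plane {E : Type*} [NormedAddCommGroup E] [InnerProductSpace ℝ E]
    [FiniteDimensional ℝ E] [MeasurableSpace E] [BorelSpace E] (hE : Module.finrank ℝ E = 2)
    (f : ℝ → ℝ) :
    ∫ x : E, f ‖x‖ = 2 * Real.pi * ∫ y in Set.Ioi (0 : ℝ), y * f y := by
  have : Nontrivial E := Module.nontrivial_of_finrank_pos (R := ℝ) (by omega)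
  rw [integral_fun_norm_addHaar volume f, hE, measureReal_def,
    InnerProductSpace.volume_ball_of_dim_even (k := 1) (by simpa using hE)]
  simp [ENNReal.toReal_ofReal Real.pi_pos.le]
  ring

theorem integral_Ioi_mul_exp_neg_sq (t : ℝ) :
    ∫ y in Set.Ioi t, y * Real.exp (-y ^ 2) = Real.exp (-t ^ 2) / 2 := by
  have hd : ∀ y : ℝ, HasDerivAt (fun y => -(Real.exp (-y ^ 2) / 2)) (y * Real.exp (-y ^ 2)) y := by
    intro y
    have := (((hasDerivAt_pow 2 y).fun_neg.exp).div_const 2).fun_neg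
    refine this.congr_deriv ?_
    push_cast
    ring
  have hi : Integrable fun y : ℝ => y * Real.exp (-y ^ 2) := by
    simpa using integrable_mul_exp_neg_mul_sq (b := 1) one_pos
  have hl : Filter.Tendsto (fun y : ℝ => -(Real.exp (-y ^ 2) / 2)) Filter.atTop (nhds 0) := by
    have : Filter.Tendsto (fun y : ℝ => Real.exp (-y ^ 2)) Filter.atTop (nhds 0) :=
      Real.tendsto_exp_atBot.comp
        (Filter.tendsto_neg_atTop_atBot.comp (Filter.tendsto_pow_atTop two_ne_zero))
    simpa using (this.div_const 2).neg
  rw [integral_Ioi_of_hasDerivAt_of_tendsto' (fun y _ => hd y) hi.integrableOn hl]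
  ring

/-- The squared modulus of a standard complex Gaussian is exponentially distributed. -/
theorem stdComplexGaussian_setOf_le_norm_sq (a : ℝ≥0∞) :
    stdComplexGaussian {z | a ≤ ENNReal.ofReal (‖z‖ ^ 2)} = negExp a := by
  obtain rfl | ha := eq_or_ne a ∞
  · simp [negExp_top]
  obtain ⟨t, ht, rfl⟩ : ∃ t : ℝ, 0 ≤ t ∧ a = ENNReal.ofReal t :=
    ⟨a.toReal, ENNReal.toReal_nonneg, (ENNReal.ofReal_toReal ha).symm⟩
  have hset : {z : ℂ | ENNReal.ofReal t ≤ ENNReal.ofReal (‖z‖ ^ 2)} = {z : ℂ | √t ≤ ‖z‖} := by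
    ext z
    rw [Set.mem_ofPred_eq, Set.mem_ofPred_eq, ENNReal.ofReal_le_ofReal_iff (by positivity),
      Real.sqrt_le_left (norm_nonneg _)]
  have hms : MeasurableSet {z : ℂ | √t ≤ ‖z‖} := measurableSet_le measurable_const measurable_norm
  have hint : Integrable fun z : ℂ => Real.pi⁻¹ * Real.exp (-‖z‖ ^ 2) := by
    -- The Bochner integral of a non-integrable function is 0, so computing a nonzero value proves
    -- integrability.
    refine Integrable.of_integral_ne_zero ?_
    rw [integral_fun_norm_plane (by simp) (fun y => Real.pi⁻¹ * Real.exp (-y ^ 2))]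
    simp_rw [mul_left_comm _ Real.pi⁻¹, integral_const_mul, integral_Ioi_mul_exp_neg_sq]
    positivity
  rw [hset, stdComplexGaussian_eq_withDensity, withDensity_apply _ hms,
    ← ofReal_integral_eq_lintegral_ofReal hint.integrableOn
      (Filter.Eventually.of_forall fun z => by positivity), negExp_ofReal ht,
    ← integral_indicator hms]
  congr 1
  have hind : ∀ z : ℂ, {z : ℂ | √t ≤ ‖z‖}.indicator (fun z => Real.pi⁻¹ * Real.exp (-‖z‖ ^ 2)) z =
      (Set.Ici √t).indicator (fun y => Real.pi⁻¹ * Real.exp (-y ^ 2)) ‖z‖ := fun z => rfl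
  simp_rw [hind]
  rw [integral_fun_norm_plane (by simp)]
  have hmul : ∀ y, y * (Set.Ici √t).indicator (fun y => Real.pi⁻¹ * Real.exp (-y ^ 2)) y =
      (Set.Ici √t).indicator (fun y => Real.pi⁻¹ * (y * Real.exp (-y ^ 2))) y := fun y => by
    by_cases hy : y ∈ Set.Ici √t
    · simp only [Set.indicator_of_mem hy]; ring
    · simp only [Set.indicator_of_notMem hy, mul_zero]
  simp_rw [hmul]
  rw [setIntegral_indicator measurableSet_Ici, ← setIntegral_congr_set
    (s := Set.Ioi √t), integral_const_mul, integral_Ioi_mul_exp_neg_sq, Real.sq_sqrt ht]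
  · field_simp
  · have := (Filter.EventuallyEq.refl (ae (volume : Measure ℝ)) (Set.Ioi (0 : ℝ))).inter
      (Ioi_ae_eq_Ici (a := √t))
    rwa [Set.inter_eq_right.2 (Set.Ioi_subset_Ioi (Real.sqrt_nonneg t))] at this

theorem lintegral_exp_neg_mul_sq_gaussianReal {v : NNReal} (hv : v ≠ 0) {s : ℝ} (hs : 0 ≤ s) :
    ∫⁻ x, ENNReal.ofReal (Real.exp (-(s * x ^ 2))) ∂(gaussianReal 0 v) =
      ENNReal.ofReal ((√(1 + 2 * s * v))⁻¹) := by
  have hv' : 0 < (v : ℝ) := NNReal.coe_pos.2 (pos_iff_ne_zero.2 hv)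
  rw [← ofReal_integral_eq_lintegral_ofReal ?_ (Filter.Eventually.of_forall fun x => by positivity)]
  · rw [integral_gaussianReal_eq_integral_smul hv]
    congr 1
    have : ∀ x : ℝ, gaussianPDFReal 0 v x • Real.exp (-(s * x ^ 2)) =
        (√(2 * Real.pi * v))⁻¹ * Real.exp (-((1 + 2 * s * v) / (2 * v)) * x ^ 2) := fun x => by
      rw [gaussianPDFReal, smul_eq_mul, mul_assoc, ← Real.exp_add]
      congr 2
      field_simp
      ring
    simp_rw [this]
    rw [integral_const_mul, integral_gaussian, ← Real.sqrt_inv, ← Real.sqrt_inv,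
      ← Real.sqrt_mul (by positivity)]
    congr 1
    field_simp
  · refine Integrable.mono' (integrable_const 1) (by fun_prop)
      (Filter.Eventually.of_forall fun x => ?_)
    rw [Real.norm_of_nonneg (Real.exp_pos _).le, Real.exp_le_one_iff, neg_nonpos]
    positivity

/-- The value `1/(1 + a)` is written as `exp(-log(1 + a))` so that a product over interferers is
again `negExp` of a series, the form the Laplace functional requires. -/
theorem lintegral_negExp_mul_norm_sq_stdComplexGaussian {a : ℝ} (ha : 0 ≤ a) :
    ∫⁻ z, negExp (ENNReal.ofReal (a * ‖z‖ ^ 2)) ∂stdComplexGaussian =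
      negExp (ENNReal.ofReal (Real.log (1 + a))) := by
  have hm : Measurable (fun z : ℝ × ℝ => (⟨z.1, z.2⟩ : ℂ)) :=
    Complex.measurableEquivRealProd.symm.measurable
  have hf : Measurable fun z : ℂ => negExp (ENNReal.ofReal (a * ‖z‖ ^ 2)) :=
    measurable_negExp.comp (by fun_prop)
  rw [stdComplexGaussian, lintegral_map hf hm]
  have : ∀ z : ℝ × ℝ, negExp (ENNReal.ofReal (a * ‖(⟨z.1, z.2⟩ : ℂ)‖ ^ 2)) =
      ENNReal.ofReal (Real.exp (-(a * z.1 ^ 2))) * ENNReal.ofReal (Real.exp (-(a * z.2 ^ 2))) :=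
    fun z => by
      rw [negExp_ofReal (by positivity), ← ENNReal.ofReal_mul (by positivity), ← Real.exp_add,
        ← Complex.normSq_eq_norm_sq, Complex.normSq_mk]
      congr 2
      ring
  simp_rw [this]
  rw [lintegral_prod_mul (f := fun x : ℝ => ENNReal.ofReal (Real.exp (-(a * x ^ 2))))
      (g := fun x : ℝ => ENNReal.ofReal (Real.exp (-(a * x ^ 2)))) (by fun_prop) (by fun_prop),
    lintegral_exp_neg_mul_sq_gaussianReal (by simp) ha, ← ENNReal.ofReal_mul (by positivity),
    ← mul_inv, Real.mul_self_sqrt (by positivity), negExp_ofReal (Real.log_nonneg (by linarith)),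
    Real.exp_neg, Real.exp_log (by positivity)]
  congr 2
  push_cast
  ring

/-- Each of the `2n` independent squares contributes `(1 + 2s)^(-1/2)`. -/
theorem lintegral_negExp_mul_chiSquared (n : ℕ) {s : ℝ} (hs : 0 ≤ s) :
    ∫⁻ z, negExp (ENNReal.ofReal (s * z)) ∂(chiSquared (2 * n)) =
      ENNReal.ofReal (((1 + 2 * s) ^ n)⁻¹) := by
  have hf : Measurable fun z => negExp (ENNReal.ofReal (s * z)) :=
    measurable_negExp.comp (by fun_prop)
  rw [chiSquared, lintegral_map hf (by fun_prop)]
  have : ∀ z : Fin (2 * n) → ℝ, negExp (ENNReal.ofReal (s * ∑ i, z i ^ 2)) =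
      ∏ i, ENNReal.ofReal (Real.exp (-(s * z i ^ 2))) := fun z => by
    rw [Finset.mul_sum, ENNReal.ofReal_sum_of_nonneg fun i _ => by positivity, negExp_sum]
    exact Finset.prod_congr rfl fun i _ => negExp_ofReal (by positivity)
  have hm : Measurable fun x : ℝ => ENNReal.ofReal (Real.exp (-(s * x ^ 2))) := by fun_prop
  simp_rw [this]
  rw [lintegral_prod_eq_prod_lintegral_of_indepFun Finset.univ
    (fun i (z : Fin (2 * n) → ℝ) => ENNReal.ofReal (Real.exp (-(s * z i ^ 2))))
    (iIndepFun_pi fun _ => hm.aemeasurable) fun i => hm.comp (measurable_pi_apply i)]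
  have hi : ∀ i : Fin (2 * n), ∫⁻ z : Fin (2 * n) → ℝ, ENNReal.ofReal (Real.exp (-(s * z i ^ 2)))
      ∂(Measure.pi fun _ => gaussianReal 0 1) = ENNReal.ofReal ((√(1 + 2 * s * (1 : NNReal)))⁻¹) :=
    fun i => by
      rw [(measurePreserving_eval (fun _ => gaussianReal 0 1) i).lintegral_comp hm,
        lintegral_exp_neg_mul_sq_gaussianReal one_ne_zero hs]
  simp_rw [hi]
  rw [Finset.prod_const, Finset.card_univ, Fintype.card_fin, pow_mul,
    ← ENNReal.ofReal_pow (by positivity), ← ENNReal.ofReal_pow (by positivity), inv_pow,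
    Real.sq_sqrt (by positivity), inv_pow]
  simp

/-! ### The pathloss integral over the plane. -/

/-- Writing `1/(1 + v) = ∫ exp(-(1 + v)t) dt` and swapping by Tonelli leaves `Γ(a) Γ(1 - a)`, to
which the reflection formula applies. -/
theorem lintegral_Ioi_rpow_div_one_add {a : ℝ} (h0 : 0 < a) (h1 : a < 1) :
    ∫⁻ v in Set.Ioi (0 : ℝ), ENNReal.ofReal (v ^ (a - 1) / (1 + v)) =
      ENNReal.ofReal (Real.pi / Real.sin (Real.pi * a)) := by
  have key : ∀ b r : ℝ, 0 < b → 0 < r →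
      ∫⁻ t in Set.Ioi (0 : ℝ), ENNReal.ofReal (t ^ (b - 1) * Real.exp (-(r * t))) =
        ENNReal.ofReal ((1 / r) ^ b * Real.Gamma b) := fun b r hb hr => by
    have h := Real.integral_rpow_mul_exp_neg_mul_Ioi hb hr
    rw [← h, ofReal_integral_eq_lintegral_ofReal]
    · refine Integrable.of_integral_ne_zero ?_
      rw [h]
      have := Real.Gamma_pos_of_pos hb
      positivity
    · filter_upwards [self_mem_ae_restrict measurableSet_Ioi] with t ht
      have := Set.mem_Ioi.1 ht
      positivity
  have h2 : ∀ v ∈ Set.Ioi (0 : ℝ), ENNReal.ofReal (v ^ (a - 1) / (1 + v)) =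
      ∫⁻ t in Set.Ioi (0 : ℝ), ENNReal.ofReal (v ^ (a - 1) * Real.exp (-((1 + v) * t))) := by
    intro v hv
    have hv : 0 < v := hv
    have := key 1 (1 + v) one_pos (by positivity)
    simp only [sub_self, Real.rpow_zero, one_mul, Real.rpow_one, Real.Gamma_one, mul_one] at this
    simp_rw [ENNReal.ofReal_mul (show 0 ≤ v ^ (a - 1) by positivity)]
    rw [lintegral_const_mul _ (by fun_prop), this, ← ENNReal.ofReal_mul (by positivity), mul_one_div]
  have h3 : ∀ t ∈ Set.Ioi (0 : ℝ),
      ∫⁻ v in Set.Ioi (0 : ℝ), ENNReal.ofReal (v ^ (a - 1) * Real.exp (-((1 + v) * t))) =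
        ENNReal.ofReal (Real.Gamma a) * ENNReal.ofReal (t ^ ((1 - a) - 1) * Real.exp (-(1 * t))) := by
    intro t ht
    have ht : 0 < t := ht
    have e : ∀ v : ℝ, ENNReal.ofReal (v ^ (a - 1) * Real.exp (-((1 + v) * t))) =
        ENNReal.ofReal (Real.exp (-(1 * t))) *
          ENNReal.ofReal (v ^ (a - 1) * Real.exp (-(t * v))) := fun v => by
      rw [← ENNReal.ofReal_mul (by positivity), mul_left_comm, ← Real.exp_add]
      congr 3
      ring
    simp_rw [e]
    rw [lintegral_const_mul _ (by fun_prop), key a t h0 ht,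
      ← ENNReal.ofReal_mul (by positivity), ← ENNReal.ofReal_mul (Real.Gamma_pos_of_pos h0).le,
      one_div, Real.inv_rpow ht.le, ← Real.rpow_neg ht.le, show 1 - a - 1 = -a by ring]
    congr 1
    ring
  rw [setLIntegral_congr_fun measurableSet_Ioi h2, lintegral_lintegral_swap (by fun_prop),
    setLIntegral_congr_fun measurableSet_Ioi h3, lintegral_const_mul _ (by fun_prop),
    key (1 - a) 1 (by linarith) one_pos, ← ENNReal.ofReal_mul (Real.Gamma_pos_of_pos h0).le]
  simp [Real.Gamma_mul_Gamma_one_sub]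

theorem integral_Ioi_rpow_div_one_add {a : ℝ} (h0 : 0 < a) (h1 : a < 1) :
    ∫ v in Set.Ioi (0 : ℝ), v ^ (a - 1) / (1 + v) = Real.pi / Real.sin (Real.pi * a) := by
  rw [integral_eq_lintegral_of_nonneg_ae _ (Measurable.aestronglyMeasurable (by fun_prop)),
    lintegral_Ioi_rpow_div_one_add h0 h1,
    ENNReal.toReal_ofReal]
  · have := Real.sin_pos_of_pos_of_lt_pi (x := Real.pi * a) (by positivity)
      (by nlinarith [Real.pi_pos])
    positivity
  · filter_upwards [self_mem_ae_restrict measurableSet_Ioi] with v hv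
    have := Set.mem_Ioi.1 hv
    positivity

/-- The substitutions `u = y^α` and `u = s v` reduce this to the preceding integral with `a = 2/α`;
`α > 2` is what puts `a` below 1. -/
theorem integral_Ioi_mul_pathloss {s α : ℝ} (hs : 0 < s) (hα : 2 < α) :
    ∫ y in Set.Ioi (0 : ℝ), y * (s * y ^ (-α) / (1 + s * y ^ (-α))) =
      α⁻¹ * (s ^ (2 / α) * (Real.pi / Real.sin (Real.pi * (2 / α)))) := by
  have hα0 : 0 < α := by linarith
  set g : ℝ → ℝ := fun u => α⁻¹ * (u ^ (2 / α - 1) * s / (u + s)) with hg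
  have h1 : ∀ y ∈ Set.Ioi (0 : ℝ), y * (s * y ^ (-α) / (1 + s * y ^ (-α))) =
      (α * y ^ (α - 1)) • g (y ^ α) := by
    intro y hy
    have hy : 0 < y := hy
    have hyα : 0 < y ^ α := by positivity
    have e : y = y ^ (α - 1) * (y ^ α) ^ (2 / α - 1) := by
      rw [← Real.rpow_mul hy.le, ← Real.rpow_add hy]
      conv_lhs => rw [← Real.rpow_one y]
      congr 1
      field_simp
      ring
    have e' : s * y ^ (-α) / (1 + s * y ^ (-α)) = s / (y ^ α + s) := by
      rw [Real.rpow_neg hy.le]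
      field_simp
    simp only [hg, smul_eq_mul]
    rw [e']
    generalize (y ^ α) ^ (2 / α - 1) = w at e ⊢
    rw [mul_div_assoc', mul_div_assoc', mul_div_assoc']
    congr 1
    rw [show α * y ^ (α - 1) * (α⁻¹ * (w * s)) = y ^ (α - 1) * w * s by field_simp, ← e]
  have h2 : ∀ v ∈ Set.Ioi (0 : ℝ), g (s * v) =
      α⁻¹ * s ^ (2 / α - 1) * (v ^ (2 / α - 1) / (1 + v)) := by
    intro v hv
    have hv : 0 < v := hv
    simp only [hg]
    rw [Real.mul_rpow hs.le hv.le]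
    field_simp
    ring
  have h3 := integral_comp_mul_left_Ioi g 0 hs
  rw [mul_zero, setIntegral_congr_fun measurableSet_Ioi h2, integral_const_mul,
    integral_Ioi_rpow_div_one_add (by positivity) (by rw [div_lt_one hα0]; exact hα)] at h3
  rw [setIntegral_congr_fun measurableSet_Ioi h1, integral_comp_rpow_Ioi_of_pos hα0]
  rw [smul_eq_mul, eq_inv_mul_iff_mul_eq₀ hs.ne'] at h3
  rw [← h3, Real.rpow_sub_one hs.ne']
  field_simp

/-- The exponent of the Laplace functional of the interference, for the power-law pathloss. -/
theorem lintegral_one_sub_negExp_log_pathloss {s α : ℝ} (hs : 0 < s) (hα : 2 < α) :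
    ∫⁻ x : Plane, (1 - negExp (ENNReal.ofReal (Real.log (1 + s * ‖x‖ ^ (-α))))) =
      ENNReal.ofReal (Real.pi * s ^ (2 / α) / normalizedSinc (2 / α)) := by
  have hα0 : 0 < α := by linarith
  have hsin : 0 < Real.sin (Real.pi * (2 / α)) :=
    Real.sin_pos_of_pos_of_lt_pi (by positivity)
      (mul_lt_of_lt_one_right Real.pi_pos (by rw [div_lt_one hα0]; exact hα))
  have h1 : ∀ x : Plane, 1 - negExp (ENNReal.ofReal (Real.log (1 + s * ‖x‖ ^ (-α)))) =
      ENNReal.ofReal (s * ‖x‖ ^ (-α) / (1 + s * ‖x‖ ^ (-α))) := fun x => by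
    have hu : 0 ≤ s * ‖x‖ ^ (-α) := by positivity
    rw [negExp_ofReal (Real.log_nonneg (by linarith)), Real.exp_neg, Real.exp_log (by positivity),
      ← ENNReal.ofReal_one, ← ENNReal.ofReal_sub _ (by positivity)]
    congr 1
    field_simp
    ring
  have h2 : ∫ x : Plane, s * ‖x‖ ^ (-α) / (1 + s * ‖x‖ ^ (-α)) =
      Real.pi * s ^ (2 / α) / normalizedSinc (2 / α) := by
    rw [integral_fun_norm_plane (by simp) (fun y => s * y ^ (-α) / (1 + s * y ^ (-α))),
      integral_Ioi_mul_pathloss hs hα, normalizedSinc, Real.sinc_of_ne_zero (by positivity)]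
    field_simp
  simp_rw [h1]
  rw [← h2, ofReal_integral_eq_lintegral_ofReal]
  · refine Integrable.of_integral_ne_zero ?_
    rw [h2, normalizedSinc, Real.sinc_of_ne_zero (by positivity)]
    positivity
  · exact Filter.Eventually.of_forall fun x => by positivity

/-! ### Incomplete Beta function and the average over the cell. -/

/-- As `y < 1` stays away from the singularity at 1, `b` is unrestricted. This matters because `b =
1 - 2/α_c` may be nonpositive. -/
theorem intervalIntegrable_incompleteBeta {a b y : ℝ} (ha : 0 < a) (hy0 : 0 ≤ y) (hy : y < 1) :
    IntervalIntegrable (fun t => t ^ (a - 1) * (1 - t) ^ (b - 1)) volume 0 y := by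
  refine (intervalIntegral.intervalIntegrable_rpow' (by linarith)).mul_continuousOn ?_
  refine ContinuousOn.rpow_const (by fun_prop) fun t ht => Or.inl ?_
  rw [Set.uIcc_of_le hy0] at ht
  linarith [ht.2]

theorem hasDerivAt_incompleteBeta {a b y : ℝ} (ha : 0 < a) (hy0 : 0 < y) (hy : y < 1) :
    HasDerivAt (fun y => incompleteBeta y a b) (y ^ (a - 1) * (1 - y) ^ (b - 1)) y := by
  refine intervalIntegral.integral_hasDerivAt_right (intervalIntegrable_incompleteBeta ha hy0.le hy)
    ?_ ?_
  · exact (Measurable.stronglyMeasurable (by fun_prop)).stronglyMeasurableAtFilter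
  · exact (continuousAt_id.rpow_const (Or.inl hy0.ne')).mul
      ((continuousAt_const.sub continuousAt_id).rpow_const (Or.inl (sub_pos.2 hy).ne'))

theorem tendsto_incompleteBeta_zero {a b : ℝ} (ha : 0 < a) :
    Filter.Tendsto (fun y => incompleteBeta y a b) (nhdsWithin 0 (Set.Ioi 0)) (nhds 0) := by
  have h := intervalIntegral.continuousOn_primitive_interval'
    (intervalIntegrable_incompleteBeta (b := b) ha (show (0 : ℝ) ≤ 1 / 2 by norm_num) (by norm_num))
    Set.left_mem_uIcc 0 Set.left_mem_uIcc
  rw [ContinuousWithinAt, intervalIntegral.integral_same] at h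
  refine h.mono_left (nhdsWithin_le_of_mem ?_)
  rw [Set.uIcc_of_le (by norm_num)]
  exact Filter.mem_of_superset (Ioo_mem_nhdsGT (by norm_num)) Set.Ioo_subset_Icc_self

/-- The radial antiderivative of the base-station interference factor, as a function of
`y = 1 / (κ r ^ (-α) + 1)`. -/
noncomputable def betaPrimitive (δ a y : ℝ) : ℝ :=
  y ^ a * (1 - y) ^ (-δ) - a * incompleteBeta y a (1 - δ)

/-- Integration by parts in reverse: the Beta term cancels the part of the product rule that comes
from `y^a`. -/
theorem hasDerivAt_betaPrimitive {δ a y : ℝ} (ha : 0 < a) (hy0 : 0 < y) (hy : y < 1) :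
    HasDerivAt (betaPrimitive δ a) (δ * (y ^ a * (1 - y) ^ (-δ - 1))) y := by
  have h1 := Real.hasDerivAt_rpow_const (x := y) (p := a) (Or.inl hy0.ne')
  have h2 := ((hasDerivAt_id y).const_sub 1).rpow_const (p := -δ) (Or.inl (sub_pos.2 hy).ne')
  have h3 := (hasDerivAt_incompleteBeta (b := 1 - δ) ha hy0 hy).const_mul a
  refine ((h1.mul h2).sub h3).congr_deriv ?_
  simp only [id]
  rw [show 1 - δ - 1 = -δ by ring]
  ring

theorem tendsto_betaPrimitive_zero {δ a : ℝ} (ha : 0 < a) :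
    Filter.Tendsto (betaPrimitive δ a) (nhdsWithin 0 (Set.Ioi 0)) (nhds 0) := by
  have h1 : Filter.Tendsto (fun y : ℝ => y ^ a * (1 - y) ^ (-δ)) (nhdsWithin 0 (Set.Ioi 0))
      (nhds 0) := by
    have : ContinuousAt (fun y : ℝ => y ^ a * (1 - y) ^ (-δ)) 0 :=
      (continuousAt_id.rpow_const (Or.inr ha.le)).mul
        ((continuousAt_const.sub continuousAt_id).rpow_const (Or.inl (by norm_num)))
    have h := this.tendsto
    rw [Real.zero_rpow ha.ne', zero_mul] at h
    exact h.mono_left nhdsWithin_le_nhds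
  have h2 := h1.sub ((tendsto_incompleteBeta_zero (b := 1 - δ) ha).const_mul a)
  rwa [mul_zero, sub_zero] at h2

/-- With `y = 1/(κ r^(-α) + 1)` one has `r² = κ^δ (y/(1 - y))^δ`, so `r dr = (κ^δ/2) δ y^(δ-1) (1 -
y)^(-δ-1) dy`. The factor `y^U` then gives the derivative of `betaPrimitive` with `a = U + δ - 1`.
-/
theorem integral_mul_inv_one_add_rpow_pow {κ α R : ℝ} (hκ : 0 < κ) (hα : 0 < α) (hR : 0 < R)
    {U : ℕ} (hU : 1 ≤ U) :
    ∫ r in (0 : ℝ)..R, r * ((1 + κ * r ^ (-α)) ^ U)⁻¹ =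
      κ ^ (2 / α) / 2 * betaPrimitive (2 / α) (U + 2 / α - 1) (1 / (κ * R ^ (-α) + 1)) := by
  have hU' : (1 : ℝ) ≤ U := by exact_mod_cast hU
  have hδ : 0 < 2 / α := by positivity
  set δ := 2 / α with hδdef
  set Y : ℝ → ℝ := fun r => 1 / (κ * r ^ (-α) + 1) with hY
  have ha : 0 < U + δ - 1 := by linarith
  have hY0 : ∀ r, 0 < r → 0 < Y r := fun r hr => by simp only [hY]; positivity
  have hY1 : ∀ r, 0 < r → Y r < 1 := fun r hr => by
    simp only [hY]
    rw [div_lt_one (by positivity)]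
    have : 0 < κ * r ^ (-α) := by positivity
    linarith
  have hderiv : ∀ r, 0 < r →
      HasDerivAt (fun r => κ ^ δ / 2 * betaPrimitive δ (U + δ - 1) (Y r))
        (r * ((1 + κ * r ^ (-α)) ^ U)⁻¹) r := by
    intro r hr
    have hq : 0 < κ * r ^ (-α) + 1 := by positivity
    have h1 := ((Real.hasDerivAt_rpow_const (x := r) (p := -α) (Or.inl hr.ne')).const_mul κ).add_const 1
    have h2 : HasDerivAt Y (κ * α * r ^ (-α - 1) * Y r ^ 2) r := by
      simp only [hY, one_div]
      refine (h1.inv hq.ne').congr_deriv ?_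
      field_simp
    refine (((hasDerivAt_betaPrimitive ha (hY0 r hr) (hY1 r hr)).comp r h2).const_mul
      (κ ^ δ / 2)).congr_deriv ?_
    have hp := hY0 r hr
    have e1 : 1 - Y r = κ * r ^ (-α) * Y r := by
      simp only [hY]
      field_simp
      ring
    have e2 : (1 + κ * r ^ (-α)) ^ U = (Y r ^ (U : ℝ))⁻¹ := by
      rw [Real.rpow_natCast, ← inv_pow]
      congr 1
      simp only [hY]
      field_simp
      ring
    rw [e1, e2, inv_inv, Real.mul_rpow (by positivity) hp.le, Real.mul_rpow hκ.le (by positivity),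
      ← Real.rpow_mul hr.le]
    have e3 : κ ^ δ * κ ^ (-δ - 1) * κ = 1 := by
      rw [← Real.rpow_add hκ, ← Real.rpow_add_one hκ.ne', show δ + (-δ - 1) + 1 = 0 by ring,
        Real.rpow_zero]
    have e4 : Y r ^ (U + δ - 1) * Y r ^ (-δ - 1) * Y r ^ 2 = Y r ^ (U : ℝ) := by
      rw [← Real.rpow_add hp, ← Real.rpow_natCast, ← Real.rpow_add hp]
      congr 1
      push_cast
      ring
    have e5 : r ^ (-α * (-δ - 1)) * r ^ (-α - 1) = r := by
      rw [← Real.rpow_add hr]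
      conv_rhs => rw [← Real.rpow_one r]
      congr 1
      rw [hδdef]
      field_simp
      ring
    have e6 : δ * α = 2 := by rw [hδdef]; field_simp
    calc _ = (κ ^ δ * κ ^ (-δ - 1) * κ) * (Y r ^ (U + δ - 1) * Y r ^ (-δ - 1) * Y r ^ 2) *
          (r ^ (-α * (-δ - 1)) * r ^ (-α - 1)) * ((δ * α) / 2) := by ring
      _ = _ := by rw [e3, e4, e5, e6]; ring
  -- `Y` is discontinuous at 0: `0 ^ (-α) = 0` makes `Y 0 = 1`, while `Y r` tends to 0. Hence the
  -- fundamental theorem is used with one-sided limits.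
  have hlim : Filter.Tendsto Y (nhdsWithin 0 (Set.Ioi 0)) (nhdsWithin 0 (Set.Ioi 0)) := by
    refine tendsto_nhdsWithin_iff.2 ⟨?_, ?_⟩
    · have h := (tendsto_rpow_neg_nhdsGT_zero (neg_lt_zero.2 hα)).const_mul_atTop hκ
      simp only [hY, one_div]
      exact tendsto_inv_atTop_zero.comp (Filter.tendsto_atTop_add_const_right _ 1 h)
    · filter_upwards [self_mem_nhdsWithin] with r hr using hY0 r hr
  have hint : IntervalIntegrable (fun r : ℝ => r * ((1 + κ * r ^ (-α)) ^ U)⁻¹) volume 0 R := by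
    refine (intervalIntegral.intervalIntegrable_id (a := 0) (b := R)).mono_fun
      (Measurable.aestronglyMeasurable (by fun_prop)) ?_
    rw [Set.uIoc_of_le hR.le]
    filter_upwards [self_mem_ae_restrict measurableSet_Ioc] with r hr
    have hr : 0 < r := hr.1
    rw [norm_mul]
    refine mul_le_of_le_one_right (norm_nonneg _) ?_
    rw [Real.norm_of_nonneg (by positivity)]
    refine inv_le_one_of_one_le₀ (one_le_pow₀ ?_)
    have : 0 < κ * r ^ (-α) := by positivity
    linarith
  have h := intervalIntegral.integral_eq_sub_of_hasDerivAt_of_tendsto hR (fun r hr => hderiv r hr.1)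
    hint (((tendsto_betaPrimitive_zero ha).comp hlim).const_mul (κ ^ δ / 2))
    ((hderiv R hR).continuousAt.tendsto.mono_left nhdsWithin_le_nhds)
  rw [h, mul_zero, sub_zero]

/-- The Laplace transform of the base-station interference, averaged over the position of the
base station. -/
theorem lintegral_cond_closedBall_inv_one_add_rpow_pow {κ α R : ℝ} (hκ : 0 < κ) (hα : 0 < α)
    (hR : 0 < R) {U : ℕ} (hU : 1 ≤ U) :
    ∫⁻ z : Plane, ENNReal.ofReal (((1 + κ * ‖z‖ ^ (-α)) ^ U)⁻¹)
        ∂(ProbabilityTheory.cond volume (Metric.closedBall (0 : Plane) R)) =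
      ENNReal.ofReal (κ ^ (2 / α) / R ^ 2 *
        betaPrimitive (2 / α) (U + 2 / α - 1) (1 / (κ * R ^ (-α) + 1))) := by
  have hvol : volume (Metric.closedBall (0 : Plane) R) = ENNReal.ofReal (R ^ 2 * Real.pi) := by
    rw [EuclideanSpace.volume_closedBall_fin_two, ENNReal.ofReal_mul (by positivity),
      ENNReal.ofReal_pow hR.le]
  have hint : IntegrableOn (fun z : Plane => ((1 + κ * ‖z‖ ^ (-α)) ^ U)⁻¹)
      (Metric.closedBall (0 : Plane) R) := by
    refine Measure.integrableOn_of_bounded (M := 1) (by rw [hvol]; exact ENNReal.ofReal_ne_top)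
      (Measurable.aestronglyMeasurable (by fun_prop)) (Filter.Eventually.of_forall fun z => ?_)
    rw [Real.norm_of_nonneg (by positivity)]
    refine inv_le_one_of_one_le₀ (one_le_pow₀ ?_)
    have : 0 ≤ κ * ‖z‖ ^ (-α) := by positivity
    linarith
  have hind : ∀ z : Plane, (Metric.closedBall (0 : Plane) R).indicator
      (fun z => ((1 + κ * ‖z‖ ^ (-α)) ^ U)⁻¹) z =
      (Set.Iic R).indicator (fun r : ℝ => ((1 + κ * r ^ (-α)) ^ U)⁻¹) ‖z‖ := fun z => by
    by_cases hz : ‖z‖ ≤ R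
    · rw [Set.indicator_of_mem (mem_closedBall_zero_iff.2 hz), Set.indicator_of_mem (Set.mem_Iic.2 hz)]
    · rw [Set.indicator_of_notMem fun h => hz (mem_closedBall_zero_iff.1 h),
        Set.indicator_of_notMem fun h => hz (Set.mem_Iic.1 h)]
  have hmul : ∀ r : ℝ, r * (Set.Iic R).indicator (fun r : ℝ => ((1 + κ * r ^ (-α)) ^ U)⁻¹) r =
      (Set.Iic R).indicator (fun r : ℝ => r * ((1 + κ * r ^ (-α)) ^ U)⁻¹) r := fun r => by
    simp [Set.indicator_apply]
  have hI : ∫ z in Metric.closedBall (0 : Plane) R, ((1 + κ * ‖z‖ ^ (-α)) ^ U)⁻¹ =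
      Real.pi * κ ^ (2 / α) *
        betaPrimitive (2 / α) (U + 2 / α - 1) (1 / (κ * R ^ (-α) + 1)) := by
    rw [← integral_indicator measurableSet_closedBall]
    simp_rw [hind]
    rw [integral_fun_norm_plane (by simp)]
    simp_rw [hmul]
    rw [setIntegral_indicator measurableSet_Iic, Set.Ioi_inter_Iic,
      ← intervalIntegral.integral_of_le hR.le, integral_mul_inv_one_add_rpow_pow hκ hα hR hU]
    ring
  rw [ProbabilityTheory.cond, lintegral_smul_measure, ← ofReal_integral_eq_lintegral_ofReal hint
    (Filter.Eventually.of_forall fun z => by positivity), hI, hvol, smul_eq_mul,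
    ← ENNReal.ofReal_inv_of_pos (by positivity), ← ENNReal.ofReal_mul (by positivity)]
  congr 1
  field_simp

/-! ### Independence and conditioning. -/

/-- The σ-algebras generated over the disjoint index sets `{0}` and its complement are independent,
and the second contains that of the whole tail sequence. -/
theorem ProbabilityTheory.iIndepFun.indepFun_zero_succ {Ω α : Type*} [MeasurableSpace Ω]
    [MeasurableSpace α] {μ : Measure Ω} {g : ℕ → Ω → α} (h : iIndepFun g μ)
    (hg : ∀ j, Measurable (g j)) : IndepFun (g 0) (fun ω j => g (j + 1) ω) μ := by
  have h1 := indep_iSup_of_disjoint (fun j => (hg j).comap_le) h.iIndep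
    (S := {0}) (T := {0}ᶜ) disjoint_compl_right
  refine indep_of_indep_of_le_left (indep_of_indep_of_le_right h1 ?_) ?_
  · rw [MeasurableSpace.pi, MeasurableSpace.comap_iSup]
    refine iSup_le fun j => ?_
    rw [MeasurableSpace.comap_comp]
    exact le_iSup₂_of_le (j + 1) (by simp) le_rfl
  · exact le_iSup₂_of_le 0 (by simp) le_rfl

section Independence

variable {Ω α β : Type*} [MeasurableSpace Ω] [MeasurableSpace α] [MeasurableSpace β]
  {μ : Measure Ω} [IsProbabilityMeasure μ] {X : Ω → α} {Y : Ω → β}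

theorem ProbabilityTheory.IndepFun.lintegral_comp_prodMk (h : IndepFun X Y μ) (hX : Measurable X)
    (hY : Measurable Y) {F : α × β → ℝ≥0∞} (hF : Measurable F) :
    ∫⁻ ω, F (X ω, Y ω) ∂μ = ∫⁻ ω, ∫⁻ ω', F (X ω', Y ω) ∂μ ∂μ := by
  have := Measure.isProbabilityMeasure_map hX.aemeasurable (μ := μ)
  have := Measure.isProbabilityMeasure_map hY.aemeasurable (μ := μ)
  rw [← lintegral_map hF (hX.prodMk hY),
    (indepFun_iff_map_prod_eq_prod_map_map hX.aemeasurable hY.aemeasurable).1 h,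
    lintegral_prod_symm' _ hF, lintegral_map hF.lintegral_prod_left' hY]
  exact lintegral_congr fun ω => lintegral_map (hF.comp measurable_prodMk_right) hX

theorem ProbabilityTheory.IndepFun.measure_prodMk_mem (h : IndepFun X Y μ) (hX : Measurable X)
    (hY : Measurable Y) {S : Set (α × β)} (hS : MeasurableSet S) :
    μ {ω | (X ω, Y ω) ∈ S} = ∫⁻ ω, μ {ω' | (X ω', Y ω) ∈ S} ∂μ := by
  have := h.lintegral_comp_prodMk hX hY (measurable_one.indicator hS)
  refine (lintegral_indicator_one (hX.prodMk hY hS)).symm.trans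
    (this.trans (lintegral_congr fun ω => ?_))
  exact lintegral_indicator_one ((hX.prodMk measurable_const) hS)

end Independence

/-! ### Averaging over Rayleigh fading. -/

section Fading

variable {Ω : Type*} [MeasurableSpace Ω] {μ : Measure Ω} [IsProbabilityMeasure μ] {g : ℕ → Ω → ℂ}

/-- Finite partial sums factor by independence; dominated convergence with bound 1 gives the series,
even a divergent one. -/
theorem lintegral_negExp_tsum_mul_norm_sq (hm : ∀ j, Measurable (g j))
    (hl : ∀ j, HasLaw (g j) stdComplexGaussian μ) (hi : iIndepFun g μ) {a : ℕ → ℝ}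
    (ha : ∀ j, 0 ≤ a j) :
    ∫⁻ ω, negExp (∑' j, ENNReal.ofReal (a j * ‖g j ω‖ ^ 2)) ∂μ =
      negExp (∑' j, ENNReal.ofReal (Real.log (1 + a j))) := by
  have hf : ∀ j, Measurable fun z : ℂ => negExp (ENNReal.ofReal (a j * ‖z‖ ^ 2)) := fun j =>
    measurable_negExp.comp (by fun_prop)
  have hfin : ∀ n, ∫⁻ ω, negExp (∑ j ∈ Finset.range n, ENNReal.ofReal (a j * ‖g j ω‖ ^ 2)) ∂μ =
      negExp (∑ j ∈ Finset.range n, ENNReal.ofReal (Real.log (1 + a j))) := fun n => by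
    simp_rw [negExp_sum]
    rw [lintegral_prod_eq_prod_lintegral_of_indepFun (Finset.range n)
      (fun j ω => negExp (ENNReal.ofReal (a j * ‖g j ω‖ ^ 2))) (hi.comp _ hf)
      fun j => (hf j).comp (hm j)]
    refine Finset.prod_congr rfl fun j _ => ?_
    rw [← lintegral_negExp_mul_norm_sq_stdComplexGaussian (ha j), ← (hl j).map_eq,
      lintegral_map (hf j) (hm j)]
  refine tendsto_nhds_unique ?_ ((tendsto_negExp_sum_range _).congr fun n => (hfin n).symm)
  refine tendsto_lintegral_of_dominated_convergence (fun _ => 1) (fun n => ?_)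
    (fun n => Filter.Eventually.of_forall fun ω => negExp_le_one _) (by simp)
    (Filter.Eventually.of_forall fun ω => tendsto_negExp_sum_range _)
  exact measurable_negExp.comp (Finset.measurable_fun_sum _ fun j _ => by
    have := hm j
    fun_prop)

/-- Coverage under Rayleigh fading, for given positions of the interferers. -/
theorem measure_tsum_add_le_norm_sq (hm : ∀ j, Measurable (g j))
    (hl : ∀ j, HasLaw (g j) stdComplexGaussian μ) (hi : iIndepFun g μ) {a : ℕ → ℝ}
    (ha : ∀ j, 0 ≤ a j) (B : ℝ≥0∞) :
    μ {ω | ∑' j, ENNReal.ofReal (a j * ‖g (j + 1) ω‖ ^ 2) + B ≤ ENNReal.ofReal (‖g 0 ω‖ ^ 2)} =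
      negExp (∑' j, ENNReal.ofReal (Real.log (1 + a j))) * negExp B := by
  have hS : MeasurableSet {z : ℂ × (ℕ → ℂ) |
      ∑' j, ENNReal.ofReal (a j * ‖z.2 j‖ ^ 2) + B ≤ ENNReal.ofReal (‖z.1‖ ^ 2)} :=
    measurableSet_le ((Measurable.tsum fun j => by fun_prop).add_const B) (by fun_prop)
  have h := (hi.indepFun_zero_succ hm).measure_prodMk_mem (hm 0)
    (measurable_pi_lambda _ fun j => hm (j + 1)) hS
  simp only [Set.mem_ofPred_eq] at h
  have htail : ∀ b : ℝ≥0∞, μ {ω | b ≤ ENNReal.ofReal (‖g 0 ω‖ ^ 2)} = negExp b := fun b => by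
    rw [← stdComplexGaussian_setOf_le_norm_sq b]
    exact (hl 0).measure_eq (p := fun z => b ≤ ENNReal.ofReal (‖z‖ ^ 2))
      (measurableSet_le measurable_const (by fun_prop))
  rw [h]
  simp_rw [htail, negExp_add]
  rw [lintegral_mul_const, lintegral_negExp_tsum_mul_norm_sq (fun j => hm (j + 1))
    (fun j => hl (j + 1)) (hi.precomp (add_left_injective 1)) ha]
  exact measurable_negExp.comp (Measurable.tsum fun j => by
    have := hm (j + 1)
    fun_prop)

end Fading

/-! ### Assembling the coverage probability. -/

namespace TypicalReceiver

variable {Ω : Type*} {p : NetworkParams} {m : TypicalReceiver p Ω}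

/-- Clearing the denominator fails only when numerator and denominator both vanish: `0 / 0 = 0` in
`[0, ∞]`, but the cleared inequality `0 ≤ 0` holds. The condition `m.g 0 ω ≠ 0`, true almost surely,
excludes this. -/
theorem le_sinr_iff (hPd : 0 < p.Pd) (hR00 : 0 < p.R00) {β x κ : ℝ} (hβ : 0 < β)
    (hx : x = p.R00 ^ p.αd / p.Pd) (hκ : κ = β * x * (p.Ac / p.Ad) * (p.Pc / p.Uc)) {ω : Ω}
    (htx : ‖m.tx 0 ω‖ = p.R00) (hg : m.g 0 ω ≠ 0) :
    ENNReal.ofReal β ≤ m.sinr ω ↔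
      ∑' j, ENNReal.ofReal (β * p.R00 ^ p.αd * ‖m.tx (j + 1) ω‖ ^ (-p.αd) * ‖m.g (j + 1) ω‖ ^ 2) +
        (ENNReal.ofReal (κ * ‖m.bs ω‖ ^ (-p.αc) * m.bsGain ω) +
          ENNReal.ofReal (β * x * (p.N0 / p.Ad))) ≤ ENNReal.ofReal (‖m.g 0 ω‖ ^ 2) := by
  have hx0 : 0 < x := by rw [hx]; positivity
  have hg' : 0 < ‖m.g 0 ω‖ := norm_pos_iff.2 hg
  have hnum : 0 < p.Pd * ‖m.tx 0 ω‖ ^ (-p.αd) * ‖m.g 0 ω‖ ^ 2 := by rw [htx]; positivity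
  rw [sinr, ENNReal.le_div_iff_mul_le (Or.inr (ENNReal.ofReal_pos.2 hnum).ne')
    (Or.inr ENNReal.ofReal_ne_top),
    ← ENNReal.mul_le_mul_iff_right (ENNReal.ofReal_pos.2 hx0).ne' ENNReal.ofReal_ne_top,
    ← ENNReal.ofReal_mul hx0.le, ← mul_assoc, ← ENNReal.ofReal_mul hx0.le]
  have e1 : x * (p.Pd * ‖m.tx 0 ω‖ ^ (-p.αd) * ‖m.g 0 ω‖ ^ 2) = ‖m.g 0 ω‖ ^ 2 := by
    rw [htx, hx, Real.rpow_neg hR00.le]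
    field_simp
  have e2 : ENNReal.ofReal (x * β) * m.d2dInterference ω = ∑' j, ENNReal.ofReal
      (β * p.R00 ^ p.αd * ‖m.tx (j + 1) ω‖ ^ (-p.αd) * ‖m.g (j + 1) ω‖ ^ 2) := by
    rw [d2dInterference, ← ENNReal.tsum_mul_left]
    refine tsum_congr fun j => ?_
    rw [← ENNReal.ofReal_mul (by positivity), hx]
    congr 1
    field_simp
  have e3 : ENNReal.ofReal (x * β) * ENNReal.ofReal (m.bsInterference ω) =
      ENNReal.ofReal (κ * ‖m.bs ω‖ ^ (-p.αc) * m.bsGain ω) := by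
    rw [← ENNReal.ofReal_mul (by positivity), bsInterference, hκ]
    congr 1
    ring
  have e4 : ENNReal.ofReal (x * β) * ENNReal.ofReal (p.N0 / p.Ad) =
      ENNReal.ofReal (β * x * (p.N0 / p.Ad)) := by
    rw [← ENNReal.ofReal_mul (by positivity), mul_comm x]
  rw [e1, mul_add, mul_add, e2, e3, e4, add_right_comm, add_comm]

variable [MeasurableSpace Ω] {μ : Measure Ω}

namespace IsModel

theorem measurable_bsGain (hm : m.IsModel μ) : Measurable m.bsGain := by
  have h1 : ∀ t, Measurable fun ω => m.f ω t := fun t => (measurable_pi_apply t).comp hm.measurable_f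
  have h2 : ∀ t u, Measurable fun ω => m.V ω t u := fun t u =>
    (measurable_pi_apply u).comp ((measurable_pi_apply t).comp hm.measurable_V)
  unfold bsGain
  refine Finset.measurable_fun_sum _ fun u _ => (Measurable.norm ?_).pow_const 2
  exact Finset.measurable_fun_sum _ fun t _ =>
    (Complex.continuous_conj.measurable.comp (h1 t)).mul (h2 t u)

theorem ae_g_ne_zero (hm : m.IsModel μ) (j : ℕ) : ∀ᵐ ω ∂μ, m.g j ω ≠ 0 := by
  refine ((hm.g_law j).ae_iff (p := (· ≠ 0)) ?_).2 ?_
  · exact measurableSet_setOfPred.1 (measurableSet_singleton (0 : ℂ)).compl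
  · rw [stdComplexGaussian_eq_withDensity]
    exact (withDensity_absolutelyContinuous _ _).ae_le (Measure.ae_ne volume 0)

theorem lintegral_negExp_bsInterference [IsProbabilityMeasure μ] (hm : m.IsModel μ)
    (hR : 0 < p.R) (hUc : 1 ≤ p.Uc) (hαc : 0 < p.αc) {κ : ℝ} (hκ : 0 < κ) :
    ∫⁻ ω, negExp (ENNReal.ofReal (κ * ‖m.bs ω‖ ^ (-p.αc) * m.bsGain ω)) ∂μ =
      ENNReal.ofReal (κ ^ (2 / p.αc) / p.R ^ 2 *
        betaPrimitive (2 / p.αc) (p.Uc + 2 / p.αc - 1) (1 / (κ * p.R ^ (-p.αc) + 1))) := by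
  have hF : Measurable fun z : ℝ × Plane =>
      negExp (ENNReal.ofReal (κ * ‖z.2‖ ^ (-p.αc) * z.1)) := measurable_negExp.comp (by fun_prop)
  have hgain : ∀ s : ℝ, 0 ≤ s → ∫⁻ ω, negExp (ENNReal.ofReal (s * m.bsGain ω)) ∂μ =
      ENNReal.ofReal (((1 + s) ^ p.Uc)⁻¹) := fun s hs => by
    -- The argument is halved because the chi-squared law is that of twice the gain.
    have h := lintegral_negExp_mul_chiSquared p.Uc (s := s / 2) (by positivity)
    have hf : Measurable fun z => negExp (ENNReal.ofReal (s / 2 * z)) :=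
      measurable_negExp.comp (by fun_prop)
    rw [← hm.gain_law.map_eq, lintegral_map' hf.aemeasurable hm.gain_law.aemeasurable,
      mul_div_cancel₀ _ two_ne_zero] at h
    rw [← h]
    refine lintegral_congr fun ω => ?_
    congr 2
    ring
  rw [hm.indep_bs.symm.lintegral_comp_prodMk hm.measurable_bsGain hm.measurable_bs hF]
  simp_rw [fun ω => hgain (κ * ‖m.bs ω‖ ^ (-p.αc)) (by positivity)]
  rw [← lintegral_cond_closedBall_inv_one_add_rpow_pow hκ hαc hR hUc, ← hm.bs_uniform,
    lintegral_map (by fun_prop) hm.measurable_bs]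

theorem lintegral_negExp_tsum_log_pathloss [IsProbabilityMeasure μ] (hm : m.IsModel μ)
    (hlamd : 0 < p.lamd) (hαd : 2 < p.αd) {s : ℝ} (hs : 0 < s) :
    ∫⁻ ω, negExp (∑' j, ENNReal.ofReal (Real.log (1 + s * ‖m.tx (j + 1) ω‖ ^ (-p.αd)))) ∂μ =
      negExp (ENNReal.ofReal (p.lamd * (Real.pi * s ^ (2 / p.αd) / normalizedSinc (2 / p.αd)))) := by
  have : SigmaFinite (ENNReal.ofReal p.lamd • volume : Measure Plane) :=
    inferInstanceAs (SigmaFinite (p.lamd.toNNReal • volume : Measure Plane))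
  rw [hm.tx_poisson.lintegral_negExp_tsum
    (φ := fun x : Plane => ENNReal.ofReal (Real.log (1 + s * ‖x‖ ^ (-p.αd)))) (by fun_prop),
    lintegral_smul_measure, lintegral_one_sub_negExp_log_pathloss hs hαd,
    ENNReal.ofReal_mul hlamd.le]
  rfl

theorem measure_le_sinr [IsProbabilityMeasure μ] (hm : m.IsModel μ)
    (hR : 0 < p.R) (hUc : 1 ≤ p.Uc) (hPc : 0 < p.Pc) (hPd : 0 < p.Pd) (hAc : 0 < p.Ac)
    (hAd : 0 < p.Ad) (hαc : 0 < p.αc) (hαd : 2 < p.αd) (hlamd : 0 < p.lamd) (hR00 : 0 < p.R00)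
    {β x κ : ℝ} (hβ : 0 < β) (hx : x = p.R00 ^ p.αd / p.Pd)
    (hκ : κ = β * x * (p.Ac / p.Ad) * (p.Pc / p.Uc)) :
    μ {ω | ENNReal.ofReal β ≤ m.sinr ω} =
      negExp (ENNReal.ofReal (p.lamd * (Real.pi * (β * p.R00 ^ p.αd) ^ (2 / p.αd) /
        normalizedSinc (2 / p.αd)))) *
      (ENNReal.ofReal (κ ^ (2 / p.αc) / p.R ^ 2 *
        betaPrimitive (2 / p.αc) (p.Uc + 2 / p.αc - 1) (1 / (κ * p.R ^ (-p.αc) + 1))) *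
      negExp (ENNReal.ofReal (β * x * (p.N0 / p.Ad)))) := by
  have hx0 : 0 < x := by rw [hx]; positivity
  have hU0 : (0 : ℝ) < p.Uc := by exact_mod_cast hUc
  have hκ0 : 0 < κ := by rw [hκ]; positivity
  have hs : 0 < β * p.R00 ^ p.αd := by positivity
  set s := β * p.R00 ^ p.αd
  set n := ENNReal.ofReal (β * x * (p.N0 / p.Ad))
  have hmg : Measurable fun ω j => m.g j ω := measurable_pi_lambda _ hm.measurable_g
  have hmtx : Measurable fun ω j => m.tx (j + 1) ω :=
    measurable_pi_lambda _ hm.tx_poisson.measurable_point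
  have hmrest : Measurable fun ω => ((fun j => m.tx (j + 1) ω : ℕ → Plane), m.bs ω, m.bsGain ω) :=
    hmtx.prodMk (hm.measurable_bs.prodMk hm.measurable_bsGain)
  have hS : MeasurableSet {z : (ℕ → ℂ) × (ℕ → Plane) × Plane × ℝ |
      ∑' j, ENNReal.ofReal (s * ‖z.2.1 j‖ ^ (-p.αd) * ‖z.1 (j + 1)‖ ^ 2) +
        (ENNReal.ofReal (κ * ‖z.2.2.1‖ ^ (-p.αc) * z.2.2.2) + n) ≤
          ENNReal.ofReal (‖z.1 0‖ ^ 2)} :=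
    measurableSet_le ((Measurable.tsum fun j => by fun_prop).add (by fun_prop)) (by fun_prop)
  -- Positions and gain are frozen here, leaving only the fading random.
  have hcov := hm.indep_fading.measure_prodMk_mem hmg hmrest hS
  simp only [Set.mem_ofPred_eq] at hcov
  have hae : μ {ω | ENNReal.ofReal β ≤ m.sinr ω} = μ {ω |
      ∑' j, ENNReal.ofReal (s * ‖m.tx (j + 1) ω‖ ^ (-p.αd) * ‖m.g (j + 1) ω‖ ^ 2) +
        (ENNReal.ofReal (κ * ‖m.bs ω‖ ^ (-p.αc) * m.bsGain ω) + n) ≤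
          ENNReal.ofReal (‖m.g 0 ω‖ ^ 2)} := by
    refine measure_congr (Filter.eventuallyEq_set.2 ?_)
    filter_upwards [hm.ae_g_ne_zero 0] with ω hω
    exact le_sinr_iff hPd hR00 hβ hx hκ (hm.norm_tx_zero ω) hω
  rw [hae, hcov]
  simp_rw [fun ω => measure_tsum_add_le_norm_sq hm.measurable_g hm.g_law hm.g_indep
    (a := fun j => s * ‖m.tx (j + 1) ω‖ ^ (-p.αd)) (fun j => by positivity)
    (ENNReal.ofReal (κ * ‖m.bs ω‖ ^ (-p.αc) * m.bsGain ω) + n)]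
  have hf1 : Measurable fun t : ℕ → Plane =>
      negExp (∑' j, ENNReal.ofReal (Real.log (1 + s * ‖t j‖ ^ (-p.αd)))) :=
    measurable_negExp.comp (Measurable.tsum fun j => by fun_prop)
  have hf2 : Measurable fun z : Plane × ℝ =>
      negExp (ENNReal.ofReal (κ * ‖z.1‖ ^ (-p.αc) * z.2) + n) :=
    measurable_negExp.comp (by fun_prop)
  have hmbg := hm.measurable_bs.prodMk hm.measurable_bsGain
  have hprod := lintegral_mul_eq_lintegral_mul_lintegral_of_indepFun''
    (hf1.comp hmtx).aemeasurable (hf2.comp hmbg).aemeasurable (hm.indep_tx.comp hf1 hf2)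
  simp only [Function.comp_def] at hprod
  rw [hprod, hm.lintegral_negExp_tsum_log_pathloss hlamd hαd hs]
  simp_rw [negExp_add]
  rw [lintegral_mul_const, hm.lintegral_negExp_bsInterference hR hUc hαc hκ0]
  have hf3 : Measurable fun z : Plane × ℝ => negExp (ENNReal.ofReal (κ * ‖z.1‖ ^ (-p.αc) * z.2)) :=
    measurable_negExp.comp (by fun_prop)
  simpa only [Function.comp_def] using hf3.comp hmbg

end IsModel

end TypicalReceiver

/-- The sign is not visible in the formula; it comes from the integral of a nonnegative function. It
is needed to pass from `ENNReal.ofReal` back to the real value. -/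
theorem betaPrimitive_nonneg {κ α R : ℝ} (hκ : 0 < κ) (hα : 0 < α) (hR : 0 < R) {U : ℕ}
    (hU : 1 ≤ U) :
    0 ≤ betaPrimitive (2 / α) (U + 2 / α - 1) (1 / (κ * R ^ (-α) + 1)) := by
  refine nonneg_of_mul_nonneg_right (a := κ ^ (2 / α) / 2) ?_ (by positivity)
  rw [← integral_mul_inv_one_add_rpow_pow hκ hα hR hU]
  refine intervalIntegral.integral_nonneg hR.le fun r hr => ?_
  have := hr.1
  positivity

theorem proposition1 {Ω : Type*} [MeasurableSpace Ω] (μ : Measure Ω) [IsProbabilityMeasure μ]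
    (p : NetworkParams) (m : TypicalReceiver p Ω) (hm : m.IsModel μ)
    (hR : 0 < p.R) (hUc : 1 ≤ p.Uc) (hPc : 0 < p.Pc) (hPd : 0 < p.Pd)
    (hAc : 0 < p.Ac) (hAd : 0 < p.Ad) (hαc : 0 < p.αc) (hαd : 2 < p.αd)
    (hlamd : 0 < p.lamd) (hR00 : 0 < p.R00) (hN0 : 0 ≤ p.N0)
    (βd x κ y : ℝ) (hβd : 0 < βd)
    (hx : x = p.R00 ^ p.αd / p.Pd)
    (hκ : κ = βd * x * (p.Ac / p.Ad) * (p.Pc / p.Uc))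
    (hy : y = 1 / (κ * p.R ^ (-p.αc) + 1)) :
    m.coverageProbability μ βd =
      κ ^ (2 / p.αc) / p.R ^ 2 *
        (y ^ (p.Uc + 2 / p.αc - 1) * (1 - y) ^ (-(2 / p.αc)) -
          (p.Uc + 2 / p.αc - 1) * incompleteBeta y (p.Uc + 2 / p.αc - 1) (1 - 2 / p.αc)) *
        Real.exp (-(Real.pi * p.lamd * p.R00 ^ 2 / normalizedSinc (2 / p.αd) *
          βd ^ (2 / p.αd))) *
        Real.exp (-(βd * x * (p.N0 / p.Ad))) := by
  have hx0 : 0 < x := by rw [hx]; positivity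
  have hU0 : (0 : ℝ) < p.Uc := by exact_mod_cast hUc
  have hκ0 : 0 < κ := by rw [hκ]; positivity
  have hαd0 : 0 < p.αd := by linarith
  have hsin : 0 < normalizedSinc (2 / p.αd) := by
    rw [normalizedSinc, Real.sinc_of_ne_zero (by positivity)]
    have := Real.sin_pos_of_pos_of_lt_pi (x := Real.pi * (2 / p.αd)) (by positivity)
      (mul_lt_of_lt_one_right Real.pi_pos (by rw [div_lt_one hαd0]; exact hαd))
    positivity
  have hb := betaPrimitive_nonneg hκ0 hαc hR hUc
  rw [TypicalReceiver.coverageProbability, measureReal_def,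
    hm.measure_le_sinr hR hUc hPc hPd hAc hAd hαc hαd hlamd hR00 hβd hx hκ,
    negExp_ofReal (by positivity), negExp_ofReal (by positivity), ENNReal.toReal_mul,
    ENNReal.toReal_mul, ENNReal.toReal_ofReal (by positivity), ENNReal.toReal_ofReal (by positivity),
    ENNReal.toReal_ofReal (by positivity), ← hy, betaPrimitive]
  have e : p.lamd * (Real.pi * (βd * p.R00 ^ p.αd) ^ (2 / p.αd) / normalizedSinc (2 / p.αd)) =
      Real.pi * p.lamd * p.R00 ^ 2 / normalizedSinc (2 / p.αd) * βd ^ (2 / p.αd) := by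
    rw [Real.mul_rpow hβd.le (by positivity), ← Real.rpow_mul hR00.le,
      mul_div_cancel₀ _ hαd0.ne', Real.rpow_two]
    ring
  rw [e]
  ring
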